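/- Let $\mathbb T^\infty$ be the countably infinite torus with its normalised Haar measure $d\theta$. Let $H^\infty(\mathbb T^\infty)$ be the space of all $f\in L^\infty(\mathbb T^\infty)$ whose Fourier coefficients satisfy $\widehat f(\nu)=0$ for every finitely supported $\nu\in\mathbb Z^\infty_0$ with at least one negative component. For such $f$ and $z\in\mathbb D^\infty\cap c_0$ put $$f(z):=\lim_{m\to\infty}\ \sum_{\nu\in\mathbb N_0^m}\widehat f(\nu_1,\dots,\nu_m,0,0,\dots)\,z_1^{\nu_1}\cdots z_m^{\nu_m}.$$ A radial approach is a sequence $r_k=(r_{n,k})_{n\ge1}$, $k\ge1$, of vectors in $[0,1)^\infty\cap c_0$ such that $r_{n,k}\to1$ as $k\to\infty$ for every $n$. We write $f(r_ke^{i\theta})=f(r_{1,k}e^{i\theta_1},r_{2,k}e^{i\theta_2},\dots)$. Theorem. There is a function $f\in H^\infty(\mathbb T^\infty)$ (for which the above limits exist at all $z\in\mathbb D^\infty\cap c_0$), with $f(z)\neq0$ for all $z\in\mathbb D^\infty\cap c_0$, such that at almost every $e^{i\theta}\in\mathbb T^\infty$ it has no unrestricted radial limit, i.e. there is no $L\in\mathbb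 C$ with $f(r_ke^{i\theta})\to L$ for all radial approaches $(r_k)$. In fact, $f$ has the following properties. (i) For almost every $e^{i\theta}\in\mathbb T^\infty$ there is a radial approach $(r_k)$ (depending on the point), with $r_{n,k}$ non-decreasing in $k$ for every $n$, along which $f(r_ke^{i\theta})$ does not converge to $f(e^{i\theta})$; indeed along it $|f(r_ke^{i\theta})|\to0$ as $k\to\infty$. (ii) There is a radial approach $(r_k)$, independent of the boundary point, such that for almost every $e^{i\theta}\in\mathbb T^\infty$ the sequence $f(r_ke^{i\theta})$ does not converge to $f(e^{i\theta})$. -/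

import Mathlib

open MeasureTheory Filter Topology
open scoped ENNReal

noncomputable section

/-- The normalised Haar measure `dθ₁ × dθ₂ × ⋯` of the infinite torus `𝕋^∞`. The torus is
`UnitAddTorus ℕ`, that is `ℕ → ℝ/ℤ`, where `θ` stands for the point `(e^{2πiθ_n})_n`. -/
def torusMeasure : Measure (UnitAddTorus ℕ) :=
  Measure.infinitePi fun _ : ℕ => (AddCircle.haarAddCircle : Measure UnitAddCircle)

/-- The character `∏_n e^{2πi ν_n θ_n}` with finitely supported frequency `ν`. -/
def torusChar (ν : ℕ →₀ ℤ) (θ : UnitAddTorus ℕ) : ℂ :=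
  ν.prod fun n k => fourier k (θ n)

/-- The Fourier coefficient of `f` at `ν`. -/
def torusCoeff (f : UnitAddTorus ℕ → ℂ) (ν : ℕ →₀ ℤ) : ℂ :=
  ∫ θ, torusChar (-ν) θ * f θ ∂torusMeasure

/-- `f` represents an element of the Hardy space `H^p(𝕋^∞)`: it is in `L^p` and its Fourier
coefficients vanish at every frequency that has a negative component. -/
def MemHardy (p : ℝ≥0∞) (f : UnitAddTorus ℕ → ℂ) : Prop :=
  MemLp f p torusMeasure ∧ ∀ ν : ℕ →₀ ℤ, (∃ n, ν n < 0) → torusCoeff f ν = 0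

/-- The set `𝔻^∞ ∩ c₀`. -/
def polydiscC0 : Set (ℕ → ℂ) :=
  {z | (∀ n, ‖z n‖ < 1) ∧ Tendsto z atTop (𝓝 0)}

/-- The Bohr section `A_m f(z) = f(z_0, …, z_{m-1}, 0, 0, …)`: the power series
`∑ f^(ν) z^ν` over the multi-indices `ν` supported in the first `m` coordinates converges
(absolutely) at `z`, with sum `s`. -/
def HasBohrSection (f : UnitAddTorus ℕ → ℂ) (m : ℕ) (z : ℕ → ℂ) (s : ℂ) : Prop :=
  HasSum (fun ν : {ν : ℕ →₀ ℕ // ν.support ⊆ Finset.range m} =>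
    torusCoeff f (ν.1.mapRange (fun k : ℕ => (k : ℤ)) Nat.cast_zero) *
      ν.1.prod fun n k => z n ^ k) s

/-- `F` is the extension of `f` to `𝔻^∞ ∩ c₀`: at each point `z` of this set, all Bohr sections of
`f` converge at `z` and their values `A_m f(z)` tend to `F z` as `m → ∞`. This determines `F` on
`𝔻^∞ ∩ c₀`. -/
def IsPolydiscExtension (f : UnitAddTorus ℕ → ℂ) (F : (ℕ → ℂ) → ℂ) : Prop :=
  ∀ z ∈ polydiscC0, ∃ S : ℕ → ℂ,
    (∀ m, HasBohrSection f m z (S m)) ∧ Tendsto S atTop (𝓝 (F z))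

/-- The point `(ρ_n e^{2πiθ_n})_n`. -/
def radialPoint (ρ : ℕ → ℝ) (θ : UnitAddTorus ℕ) : ℕ → ℂ :=
  fun n => (ρ n : ℂ) * fourier 1 (θ n)

/-- A radial approach to the boundary: a sequence of vectors of radii `r k = (r k n)_n` with
`0 ≤ r k n < 1` that lie in `c₀` and tend to `1` in each coordinate `n` as `k → ∞`. -/
structure IsRadialApproach (r : ℕ → ℕ → ℝ) : Prop where
  nonneg : ∀ k n, 0 ≤ r k n
  lt_one : ∀ k n, r k n < 1
  tendsto_zero : ∀ k, Tendsto (r k) atTop (𝓝 0)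
  tendsto_one : ∀ n, Tendsto (fun k => r k n) atTop (𝓝 1)

/-- `F` has an unrestricted radial limit at the boundary point `θ`: it has one and the same limit
at `θ` along all radial approaches. -/
def HasUnrestrictedRadialLimit (F : (ℕ → ℂ) → ℂ) (θ : UnitAddTorus ℕ) : Prop :=
  ∃ L : ℂ, ∀ r : ℕ → ℕ → ℝ, IsRadialApproach r →
    Tendsto (fun k => F (radialPoint (r k) θ)) atTop (𝓝 L)

end

/-! Take `F z = exp (-∑ a_n (P(s_n z_n) - 1))`, where `P(w) = (1 + w) / (1 - w)` has positive real
part on the disc and `s_n = 1 - 2^(-J_n)`. It is zero-free and bounded by `exp (∑ a_n)`. In each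
variable the boundary values of `Re P(s_n z)` form a Poisson kernel of mean 1, so `∑ a_n < ∞` makes
the boundary series converge almost everywhere, and the boundary function `f` does not vanish there.

The radial maximal function of that kernel behaves like `1/|t|` cut off at `2^(-J_n)`, so its mean
is of order `J_n + 1`. If `∑ a_n (J_n + 1)` diverges, choosing the worst dyadic radius in each
variable makes the modulus tend to 0: by independence the expected product of the minima over
suitable blocks of variables is at most `2^(-k)` (`integral_radialMin_le`,
`IsAdmissible.exists_blocks`). Keeping earlier radii near 1 and later ones at 0 gives a radial
approach with limit 0, which proves (i).

Each block admits only finitely many choices of dyadic levels. Listing all of them gives one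
approach that contains a suitable subsequence for almost every point, which proves (ii)
(`IsAdmissible.exists_universal_radialApproach`). -/

instance : IsProbabilityMeasure torusMeasure := by
  unfold torusMeasure; infer_instance

/-! ### Integration on the torus and one-variable Fourier coefficients -/

theorem integral_prod_torus {𝕜 : Type*} [RCLike 𝕜] (s : Finset ℕ) (h : ℕ → UnitAddCircle → 𝕜)
    (hm : ∀ n ∈ s, Measurable (h n)) :
    ∫ θ, ∏ n ∈ s, h n (θ n) ∂torusMeasure =
      ∏ n ∈ s, ∫ t, h n t ∂AddCircle.haarAddCircle := by
  have h1 : ∀ θ : UnitAddTorus ℕ, ∏ n ∈ s, h n (θ n) =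
      (fun y : (∀ _ : s, UnitAddCircle) => ∏ n : s, h n (y n)) (s.restrict θ) := by
    intro θ
    simp only [Finset.restrict]
    exact (Finset.prod_coe_sort s (fun n => h n (θ n))).symm
  simp_rw [h1]
  unfold torusMeasure
  refine (integral_restrict_infinitePi (μ := fun _ : ℕ => AddCircle.haarAddCircle)
    (f := fun y : (∀ _ : s, UnitAddCircle) => ∏ n : s, h n (y n)) ?_).trans ?_
  swap
  · rw [integral_fintype_prod_eq_prod (fun n : s => h n)]
    exact Finset.prod_coe_sort s (fun n => ∫ t, h n t ∂AddCircle.haarAddCircle)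
  · refine Measurable.aestronglyMeasurable ?_
    exact Finset.measurable_prod _ fun n _ => (hm n n.2).comp (measurable_pi_apply n)

theorem ae_summable_of_summable_integral {α : Type*} [MeasurableSpace α] {μ : Measure α}
    {X : ℕ → α → ℝ} (h0 : ∀ n x, 0 ≤ X n x) (hX : ∀ n, Integrable (X n) μ)
    (hs : Summable fun n => ∫ x, X n x ∂μ) : ∀ᵐ x ∂μ, Summable fun n => X n x := by
  have h1 : ∫⁻ x, ∑' n, ENNReal.ofReal (X n x) ∂μ ≠ ∞ := by
    rw [lintegral_tsum fun n => (hX n).1.aemeasurable.ennreal_ofReal]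
    simp_rw [← ofReal_integral_eq_lintegral_ofReal (hX _) (ae_of_all _ (h0 _))]
    exact hs.tsum_ofReal_ne_top
  have h2 := ae_lt_top' (AEMeasurable.tsum fun n => (hX n).1.aemeasurable.ennreal_ofReal) h1
  filter_upwards [h2] with x hx
  have := ENNReal.summable_toReal hx.ne
  simpa [ENNReal.toReal_ofReal (h0 _ x)] using this

theorem integral_fourier_haar (n : ℤ) :
    ∫ t : UnitAddCircle, fourier n t ∂AddCircle.haarAddCircle = if n = 0 then 1 else 0 := by
  have h := congrFun (fourierCoeff_fourier (T := 1) n) 0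
  simp only [fourierCoeff, neg_zero, fourier_zero, one_smul] at h
  rw [h, Pi.single_apply]
  simp [eq_comm]

theorem fourier_one_pow (k : ℕ) (t : UnitAddCircle) : (fourier 1 t) ^ k = fourier (k : ℤ) t := by
  induction k with
  | zero => simp
  | succ k ih => rw [pow_succ, ih, Nat.cast_succ, fourier_add]

theorem norm_fourier_apply (n : ℤ) (t : UnitAddCircle) : ‖(fourier n t : ℂ)‖ = 1 := by
  rw [fourier_apply]; exact Circle.norm_coe _

/-- A function holomorphic near the closed unit disc has an absolutely convergent Taylor series
there, and its Taylor coefficients are its Fourier coefficients on the circle. -/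
theorem exists_taylor_fourier {g : ℂ → ℂ} {R : ℝ} (hR : 1 < R)
    (hg : DifferentiableOn ℂ g (Metric.ball 0 R)) :
    ∃ c : ℕ → ℂ, (Summable fun k => ‖c k‖) ∧ c 0 = g 0 ∧
      (∀ z : ℂ, ‖z‖ ≤ 1 → HasSum (fun k => c k * z ^ k) (g z)) ∧
      ∀ j : ℤ, ∫ t : UnitAddCircle, fourier (-j) t * g (fourier 1 t) ∂AddCircle.haarAddCircle =
        if 0 ≤ j then c j.toNat else 0 := by
  set c : ℕ → ℂ := fun k => (Nat.factorial k : ℂ)⁻¹ * iteratedDeriv k g 0 with hc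
  have hsum : ∀ z : ℂ, ‖z‖ < R → HasSum (fun k => c k * z ^ k) (g z) := by
    intro z hz
    have := Complex.hasSum_taylorSeries_on_ball hg (z := z) (by simpa using hz)
    refine this.congr_fun ?_ 
    intro k
    simp [hc]; ring
  have hcs : Summable fun k => ‖c k‖ := by
    -- Convergence at a radius `ρ > 1` dominates the coefficients themselves.
    obtain ⟨ρ, h1, h2⟩ := exists_between hR
    have h3 := (hsum (ρ : ℂ) (by simpa [abs_of_pos (by linarith : 0 < ρ)] using h2)).summable.norm
    refine h3.of_nonneg_of_le (fun k => norm_nonneg _) fun k => ?_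
    rw [norm_mul (c k), norm_pow, Complex.norm_real, Real.norm_of_nonneg (by linarith)]
    exact le_mul_of_one_le_right (norm_nonneg _) (one_le_pow₀ h1.le)
  refine ⟨c, hcs, by simp [hc], fun z hz => hsum z (hz.trans_lt hR), fun j => ?_⟩
  -- Termwise integration of this series leaves only the term `k = j`, if there is one.
  have h1 : ∀ t : UnitAddCircle, fourier (-j) t * g (fourier 1 t) =
      ∑' k : ℕ, c k * fourier ((k : ℤ) - j) t := by
    intro t
    rw [← (hsum (fourier 1 t) (by rw [norm_fourier_apply]; exact hR)).tsum_eq, ← tsum_mul_left]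
    refine tsum_congr fun k => ?_
    rw [fourier_one_pow, sub_eq_add_neg, fourier_add]; ring
  simp_rw [h1]
  have h2 := hasSum_integral_of_summable_integral_norm (μ := AddCircle.haarAddCircle)
    (F := fun (k : ℕ) (t : UnitAddCircle) => c k * fourier ((k : ℤ) - j) t)
    (fun k => ((map_continuous (fourier ((k : ℤ) - j))).const_smul (c k)).integrable_of_hasCompactSupport
      (HasCompactSupport.of_compactSpace _)) (by simpa [norm_fourier_apply, -fourier_apply] using hcs)
  rw [← h2.tsum_eq]
  simp_rw [integral_const_mul, integral_fourier_haar]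
  split_ifs with hj
  · lift j to ℕ using hj
    rw [tsum_eq_single j]
    · simp
    · intro k hk
      rw [if_neg (by omega), mul_zero]
  · have h3 : ∀ k : ℕ, (if (k : ℤ) - j = 0 then (1 : ℂ) else 0) = 0 := fun k => if_neg (by omega)
    simp [h3]

/-! ### Products of power series in separate variables -/

/-- Restriction of a multi-index on the first `m + 1` variables to its first `m` and its last
component. -/
noncomputable def finsuppRangeSucc (m : ℕ) :
    {ν : ℕ →₀ ℕ // ν.support ⊆ Finset.range m} × ℕ ≃
      {ν : ℕ →₀ ℕ // ν.support ⊆ Finset.range (m + 1)} where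
  toFun p := ⟨p.1.1 + Finsupp.single m p.2, by
    intro n hn
    have h := p.1.2
    rw [Finsupp.mem_support_iff] at hn
    by_contra h'
    have h1 : p.1.1 n = 0 := by
      by_contra h2
      have := h (Finsupp.mem_support_iff.2 h2)
      simp at this h'; omega
    simp only [Finset.mem_range, not_lt] at h'
    apply hn
    rw [Finsupp.add_apply, h1, Finsupp.single_apply, if_neg (by omega), add_zero]⟩
  invFun ν := (⟨ν.1.erase m, by
    intro n hn
    rw [Finsupp.support_erase, Finset.mem_erase] at hn
    have := ν.2 hn.2
    simp at this ⊢; omega⟩, ν.1 m)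
  left_inv := by
    rintro ⟨⟨ν, hν⟩, k⟩
    have hm : ν m = 0 := by
      by_contra h2
      simpa using hν (Finsupp.mem_support_iff.2 h2)
    ext n
    · by_cases h : n = m
      · subst h; simp [hm]
      · simp [Finsupp.erase_ne h]
    · simp [hm]
  right_inv := by
    rintro ⟨ν, hν⟩
    ext n
    simp [Finsupp.erase_add_single]

/-- The product of finitely many absolutely convergent series, indexed by multi-indices. -/
theorem hasSum_prod_finsupp {b : ℕ → ℕ → ℂ} {s : ℕ → ℂ} (hb : ∀ n, HasSum (b n) (s n))
    (hn : ∀ n, Summable fun k => ‖b n k‖) (m : ℕ) :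
    HasSum (fun ν : {ν : ℕ →₀ ℕ // ν.support ⊆ Finset.range m} =>
      ∏ n ∈ Finset.range m, b n (ν.1 n)) (∏ n ∈ Finset.range m, s n) ∧
    Summable (fun ν : {ν : ℕ →₀ ℕ // ν.support ⊆ Finset.range m} =>
      ‖∏ n ∈ Finset.range m, b n (ν.1 n)‖) := by
  induction m with
  | zero =>
    have : Unique {ν : ℕ →₀ ℕ // ν.support ⊆ Finset.range 0} :=
      ⟨⟨⟨0, by simp⟩⟩, fun ν => by
        have := ν.2
        ext1
        simpa using this⟩
    simp only [Finset.range_zero, Finset.prod_empty]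
    have h := hasSum_unique (L := .unconditional _)
      (fun _ : {ν : ℕ →₀ ℕ // ν.support ⊆ Finset.range 0} => (1 : ℂ))
    exact ⟨h, h.summable.norm⟩
  | succ m ih =>
    have key : ∀ p : {ν : ℕ →₀ ℕ // ν.support ⊆ Finset.range m} × ℕ,
        ∏ n ∈ Finset.range (m + 1), b n ((finsuppRangeSucc m p).1 n) =
          (∏ n ∈ Finset.range m, b n (p.1.1 n)) * b m p.2 := by
      rintro ⟨⟨ν, hν⟩, k⟩
      have hm : ν m = 0 := by
        by_contra h2
        simpa using hν (Finsupp.mem_support_iff.2 h2)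
      rw [Finset.prod_range_succ]
      congr 1
      · refine Finset.prod_congr rfl fun n hn => ?_
        have : m ≠ n := by simp at hn; omega
        simp [finsuppRangeSucc, this]
      · simp [finsuppRangeSucc, hm]
    have hsn := Summable.mul_norm ih.2 (hn m)
    constructor
    · rw [← (finsuppRangeSucc m).hasSum_iff, Finset.prod_range_succ]
      convert! ih.1.mul (hb m) hsn.of_norm using 1
      exact funext key
    · rw [← (finsuppRangeSucc m).summable_iff]
      convert! hsn using 1
      funext p
      rw [Function.comp_apply, key]

/-! ### The one-variable factors -/

/-- The function `(1 + sz) / (1 - sz) - 1`. -/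
noncomputable def herglotz (s : ℝ) (z : ℂ) : ℂ := 2 * s * z / (1 - s * z)

/-- The bounded zero-free function `exp (-a ((1 + sz) / (1 - sz) - 1))`. -/
noncomputable def herglotzExp (a s : ℝ) (z : ℂ) : ℂ := Complex.exp (-(a * herglotz s z))

/-- The real part of `(1 + sz) / (1 - sz)`. -/
noncomputable def herglotzRe (s : ℝ) (z : ℂ) : ℝ := 1 + (herglotz s z).re

theorem one_sub_mul_ne_zero {s : ℝ} {z : ℂ} (h : ‖(s : ℂ) * z‖ < 1) : 1 - (s : ℂ) * z ≠ 0 := by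
  intro h0
  rw [← sub_eq_zero.1 h0, norm_one] at h
  exact lt_irrefl _ h

theorem norm_ofReal_mul_lt_one {s : ℝ} (h0 : 0 ≤ s) (h1 : s < 1) {z : ℂ} (hz : ‖z‖ ≤ 1) :
    ‖(s : ℂ) * z‖ < 1 := by
  rw [norm_mul, Complex.norm_real, Real.norm_of_nonneg h0]
  nlinarith [norm_nonneg z]

theorem differentiableAt_herglotz {s : ℝ} {z : ℂ} (h : ‖(s : ℂ) * z‖ < 1) :
    DifferentiableAt ℂ (herglotz s) z := by
  unfold herglotz
  have := one_sub_mul_ne_zero h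
  fun_prop (disch := assumption)

/-- The radius `2 / (1 + s)` exceeds 1 but stays below the pole `1 / s`, so the closed unit disc
lies inside the ball. -/
theorem differentiableOn_herglotz {s : ℝ} (h0 : 0 ≤ s) (h1 : s < 1) :
    DifferentiableOn ℂ (herglotz s) (Metric.ball 0 (2 / (1 + s))) := by
  intro z hz
  refine (differentiableAt_herglotz ?_).differentiableWithinAt
  rw [mem_ball_zero_iff, lt_div_iff₀ (by linarith)] at hz
  rw [norm_mul, Complex.norm_real, Real.norm_of_nonneg h0]
  by_contra! h
  nlinarith [norm_nonneg z]

theorem differentiableOn_herglotzExp (a : ℝ) {s : ℝ} (h0 : 0 ≤ s) (h1 : s < 1) :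
    DifferentiableOn ℂ (herglotzExp a s) (Metric.ball 0 (2 / (1 + s))) :=
  (((differentiableOn_herglotz h0 h1).const_mul _).neg).cexp

theorem one_lt_two_div_one_add {s : ℝ} (h0 : 0 ≤ s) (h1 : s < 1) : 1 < 2 / (1 + s) := by
  rw [one_lt_div (by linarith)]; linarith

@[simp] theorem herglotz_zero (s : ℝ) : herglotz s 0 = 0 := by simp [herglotz]

@[simp] theorem herglotzExp_zero (a s : ℝ) : herglotzExp a s 0 = 1 := by simp [herglotzExp]

theorem continuousOn_herglotz {s : ℝ} (h0 : 0 ≤ s) (h1 : s < 1) :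
    ContinuousOn (herglotz s) (Metric.closedBall 0 1) :=
  (differentiableOn_herglotz h0 h1).continuousOn.mono
    (Metric.closedBall_subset_ball (one_lt_two_div_one_add h0 h1))

theorem continuousOn_herglotzExp (a : ℝ) {s : ℝ} (h0 : 0 ≤ s) (h1 : s < 1) :
    ContinuousOn (herglotzExp a s) (Metric.closedBall 0 1) :=
  (differentiableOn_herglotzExp a h0 h1).continuousOn.mono
    (Metric.closedBall_subset_ball (one_lt_two_div_one_add h0 h1))

theorem continuous_comp_circle {E : Type*} [TopologicalSpace E] {g : ℂ → E}
    (hg : ContinuousOn g (Metric.closedBall 0 1)) {ρ : ℝ} (h0 : 0 ≤ ρ) (h1 : ρ ≤ 1) :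
    Continuous fun t : UnitAddCircle => g (ρ * fourier 1 t) := by
  refine hg.comp_continuous (by fun_prop) fun t => ?_
  rw [mem_closedBall_zero_iff, norm_mul, norm_fourier_apply, Complex.norm_real,
    Real.norm_of_nonneg h0]
  linarith

theorem herglotzRe_eq {s : ℝ} {z : ℂ} (h : ‖(s : ℂ) * z‖ < 1) :
    herglotzRe s z = (1 - ‖(s : ℂ) * z‖ ^ 2) / ‖1 - (s : ℂ) * z‖ ^ 2 := by
  have h1 := one_sub_mul_ne_zero h
  have h2 : (herglotzRe s z) = ((1 + (s : ℂ) * z) / (1 - s * z)).re := by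
    have : (1 + (s : ℂ) * z) / (1 - s * z) = 1 + herglotz s z := by
      unfold herglotz; field_simp; ring
    rw [this]; simp [herglotzRe]
  rw [h2, Complex.div_re, ← add_div, Complex.normSq_eq_norm_sq]
  congr 1
  rw [Complex.sq_norm, Complex.normSq_apply]
  simp only [Complex.add_re, Complex.sub_re, Complex.one_re, Complex.add_im, Complex.sub_im,
    Complex.one_im]
  ring

theorem herglotzRe_nonneg {s : ℝ} (h0 : 0 ≤ s) (h1 : s < 1) {z : ℂ} (hz : ‖z‖ ≤ 1) :
    0 ≤ herglotzRe s z := by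
  have h := norm_ofReal_mul_lt_one h0 h1 hz
  rw [herglotzRe_eq h]
  refine div_nonneg ?_ (sq_nonneg _)
  nlinarith [norm_nonneg ((s : ℂ) * z)]

theorem norm_herglotzExp (a s : ℝ) (z : ℂ) :
    ‖herglotzExp a s z‖ = Real.exp a * Real.exp (-(a * herglotzRe s z)) := by
  rw [herglotzExp, Complex.norm_exp, ← Real.exp_add, herglotzRe]
  congr 1
  simp; ring

theorem norm_herglotzExp_le {a s : ℝ} (ha : 0 ≤ a) (h0 : 0 ≤ s) (h1 : s < 1) {z : ℂ}
    (hz : ‖z‖ ≤ 1) : ‖herglotzExp a s z‖ ≤ Real.exp a := by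
  rw [norm_herglotzExp]
  refine mul_le_of_le_one_right (Real.exp_pos _).le (Real.exp_le_one_iff.2 ?_)
  have := mul_nonneg ha (herglotzRe_nonneg h0 h1 hz)
  linarith

/-- A bound independent of `s`: at points of `c₀` it controls the tail of the series by `∑ a_n`. -/
theorem norm_herglotz_le {s : ℝ} (h0 : 0 ≤ s) (h1 : s < 1) {z : ℂ} (hz : ‖z‖ ≤ 1 / 2) :
    ‖herglotz s z‖ ≤ 2 := by
  have h2 : ‖(s : ℂ) * z‖ ≤ 1 / 2 := by
    rw [norm_mul, Complex.norm_real, Real.norm_of_nonneg h0]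
    nlinarith [norm_nonneg z]
  have h3 : 1 / 2 ≤ ‖1 - (s : ℂ) * z‖ := by
    have := norm_sub_norm_le (1 : ℂ) (s * z)
    rw [norm_one] at this; linarith
  rw [herglotz, norm_div, div_le_iff₀ (by linarith), mul_assoc, norm_mul]
  rw [Complex.norm_ofNat]
  linarith

theorem norm_one_sub_fourier_le (t : UnitAddCircle) : ‖1 - (fourier 1 t : ℂ)‖ ≤ 7 * ‖t‖ := by
  obtain ⟨x, rfl, hx⟩ : ∃ x : ℝ, (x : UnitAddCircle) = t ∧ ‖t‖ = |x| := by
    obtain ⟨y, rfl⟩ := QuotientAddGroup.mk_surjective t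
    refine ⟨y - round y, ?_, UnitAddCircle.norm_eq⟩
    have : ((round y : ℝ) : UnitAddCircle) = 0 := by
      rw [AddCircle.coe_eq_zero_iff]; exact ⟨round y, by simp⟩
    rw [AddCircle.coe_sub, this, sub_zero]
  rw [hx, norm_sub_rev, fourier_coe_apply]
  have := Real.norm_exp_I_mul_ofReal_sub_one_le (x := 2 * Real.pi * x)
  rw [show (2 * Real.pi * Complex.I * (1 : ℤ) * x / (1 : ℝ) : ℂ)
    = Complex.I * (2 * Real.pi * x : ℝ) by push_cast; ring]
  refine this.trans ?_
  rw [Real.norm_eq_abs, abs_mul, abs_of_pos (by positivity)]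
  have := Real.pi_lt_d2
  exact mul_le_mul_of_nonneg_right (by linarith) (abs_nonneg _)

/-! ### Dyadic radii and the radial minimum -/

/-- The radius `1 - 2⁻ʲ`. -/
noncomputable def dyadicRadius (j : ℕ) : ℝ := 1 - (1 / 2) ^ j

theorem dyadicRadius_nonneg (j : ℕ) : 0 ≤ dyadicRadius j :=
  sub_nonneg.2 (pow_le_one₀ (by norm_num) (by norm_num))

theorem dyadicRadius_lt_one (j : ℕ) : dyadicRadius j < 1 := by
  unfold dyadicRadius
  have : (0 : ℝ) < (1 / 2) ^ j := by positivity
  linarith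

theorem norm_dyadicRadius_mul_fourier_le (j : ℕ) (t : UnitAddCircle) :
    ‖(dyadicRadius j : ℂ) * fourier 1 t‖ ≤ 1 := by
  rw [norm_mul, norm_fourier_apply, Complex.norm_real, Real.norm_of_nonneg (dyadicRadius_nonneg j),
    mul_one]
  exact (dyadicRadius_lt_one j).le

/-- With `x = 2^(-j)`, the total radius `q` lies in `[1 - 2x, 1 - x]`. The Poisson numerator is then
at least `x`, and the denominator at most `(2x + 7x)²`, whence the constant 81. -/
theorem le_herglotzRe_dyadicRadius {j J : ℕ} (hj : j ≤ J) {t : UnitAddCircle}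
    (ht : ‖t‖ ≤ (1 / 2) ^ j) :
    2 ^ j / 81 ≤ herglotzRe (dyadicRadius J) (dyadicRadius j * fourier 1 t) := by
  have hlt := norm_ofReal_mul_lt_one (dyadicRadius_nonneg J) (dyadicRadius_lt_one J)
    (norm_dyadicRadius_mul_fourier_le j t)
  rw [herglotzRe_eq hlt]
  set x : ℝ := (1 / 2) ^ j with hx
  have hx0 : 0 < x := by positivity
  have hx1 : x ≤ 1 := pow_le_one₀ (by norm_num) (by norm_num)
  have hJ : (1 / 2 : ℝ) ^ J ≤ x := pow_le_pow_of_le_one (by norm_num) (by norm_num) hj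
  have hJ0 : (0 : ℝ) < (1 / 2) ^ J := by positivity
  have e2 : (2 : ℝ) ^ j = 1 / x := by rw [hx]; simp
  set q : ℝ := dyadicRadius J * dyadicRadius j with hq
  have hq0 : 0 ≤ q := mul_nonneg (dyadicRadius_nonneg _) (dyadicRadius_nonneg _)
  have hq1 : q ≤ 1 - x := by
    have := mul_le_of_le_one_left (dyadicRadius_nonneg j) (dyadicRadius_lt_one J).le
    exact this
  have hq2 : 1 - 2 * x ≤ q := by
    rw [hq]; unfold dyadicRadius; rw [← hx]; nlinarith
  have hw : (dyadicRadius J : ℂ) * (dyadicRadius j * fourier 1 t) = (q : ℂ) * fourier 1 t := by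
    rw [hq]; push_cast; ring
  rw [hw] at hlt ⊢
  have hn : ‖(q : ℂ) * fourier 1 t‖ = q := by
    rw [norm_mul, norm_fourier_apply, Complex.norm_real, Real.norm_of_nonneg hq0, mul_one]
  have hd : ‖1 - (q : ℂ) * fourier 1 t‖ ≤ 9 * x := by
    have h1 : 1 - (q : ℂ) * fourier 1 t = ((1 - q : ℝ) : ℂ) + q * (1 - fourier 1 t) := by
      push_cast; ring
    rw [h1]
    refine (norm_add_le _ _).trans ?_
    rw [Complex.norm_real, norm_mul, Complex.norm_real, Real.norm_of_nonneg hq0,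
      Real.norm_of_nonneg (by linarith)]
    have := norm_one_sub_fourier_le t
    nlinarith [norm_nonneg (1 - (fourier 1 t : ℂ))]
  have hd0 : 0 < ‖1 - (q : ℂ) * fourier 1 t‖ := norm_pos_iff.2 (one_sub_mul_ne_zero hlt)
  rw [hn, e2, le_div_iff₀ (by positivity)]
  have : ‖1 - (q : ℂ) * fourier 1 t‖ ^ 2 ≤ (9 * x) ^ 2 := pow_le_pow_left₀ hd0.le hd 2
  calc 1 / x / 81 * ‖1 - (q : ℂ) * fourier 1 t‖ ^ 2 ≤ 1 / x / 81 * (9 * x) ^ 2 := by gcongr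
    _ = x := by field_simp; norm_num
    _ ≤ 1 - q ^ 2 := by nlinarith

/-- The deficit `1 - ψ` dominates `c/2` times a sum of bumps `2^j` on the balls of radius `2^(-j)`:
at each point this geometric sum is at most twice its last nonzero term. Each of the `J + 1` bumps
has integral at least 1. -/
theorem integral_le_of_le_on_dyadic_balls {ψ : UnitAddCircle → ℝ} (hψ : Continuous ψ)
    (h1 : ∀ t, ψ t ≤ 1) {c : ℝ} (hc : 0 ≤ c) (J : ℕ)
    (hj : ∀ j ≤ J, ∀ t : UnitAddCircle, ‖t‖ ≤ (1 / 2) ^ j → ψ t ≤ 1 - c * 2 ^ j) :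
    ∫ t, ψ t ∂AddCircle.haarAddCircle ≤ 1 - c / 2 * (J + 1) := by
  set B : ℕ → UnitAddCircle → ℝ :=
    fun j => (Metric.closedBall (0 : UnitAddCircle) ((1 / 2) ^ j)).indicator (fun _ => 2 ^ j)
  have key : ∀ K ≤ J, ∀ t, ψ t ≤ 1 - c / 2 * ∑ j ∈ Finset.range (K + 1), B j t := by
    intro K
    induction K with
    | zero =>
      intro _ t
      have h := hj 0 (Nat.zero_le _) t
      by_cases ht : ‖t‖ ≤ (1 / 2) ^ 0
      · have := h ht
        simp only [B, Finset.sum_range_one, zero_add]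
        rw [Set.indicator_of_mem (mem_closedBall_zero_iff.2 ht)]
        simp only [pow_zero] at this ⊢; linarith
      · simp only [B, Finset.sum_range_one, zero_add]
        rw [Set.indicator_of_notMem (by rwa [mem_closedBall_zero_iff])]
        simpa using h1 t
    | succ K ih =>
      intro hK t
      by_cases ht : ‖t‖ ≤ (1 / 2) ^ (K + 1)
      · have h := hj (K + 1) hK t ht
        have hs : ∑ j ∈ Finset.range (K + 1 + 1), B j t ≤ 2 * 2 ^ (K + 1) := by
          calc ∑ j ∈ Finset.range (K + 1 + 1), B j t
              ≤ ∑ j ∈ Finset.range (K + 1 + 1), (2 : ℝ) ^ j :=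
                Finset.sum_le_sum fun j _ => Set.indicator_apply_le' (fun _ => le_rfl)
                  (fun _ => by positivity)
            _ ≤ 2 * 2 ^ (K + 1) := by
                rw [geom_sum_eq (by norm_num), pow_succ _ (K + 1)]; norm_num; linarith
        nlinarith
      · rw [Finset.sum_range_succ]
        have : B (K + 1) t = 0 := Set.indicator_of_notMem (by rwa [mem_closedBall_zero_iff]) _
        rw [this, add_zero]
        exact ih (by omega) t
  have hvol : (volume : Measure UnitAddCircle) = AddCircle.haarAddCircle := by
    rw [AddCircle.volume_eq_smul_haarAddCircle]; simp
  have hBi : ∀ j, Integrable (B j) AddCircle.haarAddCircle := fun j =>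
    (integrable_const _).indicator measurableSet_closedBall
  have hBint : ∀ j, 1 ≤ ∫ t, B j t ∂AddCircle.haarAddCircle := by
    intro j
    rw [integral_indicator_const _ measurableSet_closedBall, measureReal_def, ← hvol,
      AddCircle.volume_closedBall, smul_eq_mul]
    have h0 : (0 : ℝ) < (1 / 2) ^ j := by positivity
    rw [ENNReal.toReal_ofReal (le_min zero_le_one (by positivity))]
    have h2 : (1 / 2 : ℝ) ^ j * 2 ^ j = 1 := by rw [← mul_pow]; norm_num
    calc (1 : ℝ) = (1 / 2 : ℝ) ^ j * 2 ^ j := h2.symm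
      _ ≤ _ := by
        gcongr
        exact le_min (pow_le_one₀ (by norm_num) (by norm_num)) (by linarith)
  have hψi : Integrable ψ AddCircle.haarAddCircle :=
    hψ.integrable_of_hasCompactSupport (HasCompactSupport.of_compactSpace _)
  calc ∫ t, ψ t ∂AddCircle.haarAddCircle
      ≤ ∫ t, (1 - c / 2 * ∑ j ∈ Finset.range (J + 1), B j t) ∂AddCircle.haarAddCircle :=
        integral_mono hψi ((integrable_const _).sub
          ((integrable_finsetSum _ fun j _ => hBi j).const_mul _)) (key J le_rfl)
    _ = 1 - c / 2 * ∑ j ∈ Finset.range (J + 1), ∫ t, B j t ∂AddCircle.haarAddCircle := by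
        rw [integral_sub (integrable_const _)
          ((integrable_finsetSum _ fun j _ => hBi j).const_mul _), integral_const_mul,
          integral_finsetSum _ fun j _ => hBi j]
        simp
    _ ≤ 1 - c / 2 * (J + 1) := by
        have : ((J : ℝ) + 1) ≤ ∑ j ∈ Finset.range (J + 1), ∫ t, B j t ∂AddCircle.haarAddCircle := by
          calc ((J : ℝ) + 1) = ∑ j ∈ Finset.range (J + 1), (1 : ℝ) := by simp
            _ ≤ _ := Finset.sum_le_sum fun j _ => hBint j
        have := mul_le_mul_of_nonneg_left this (by positivity : 0 ≤ c / 2)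
        linarith

/-- The minimum over the dyadic radii up to level `J` of `exp (-a Re ((1 + sz) / (1 - sz)))`,
where `s = 1 - 2⁻ᴶ`. -/
noncomputable def radialMin (a : ℝ) (J : ℕ) (t : UnitAddCircle) : ℝ :=
  (Finset.range (J + 1)).inf' Finset.nonempty_range_add_one fun j =>
    Real.exp (-(a * herglotzRe (dyadicRadius J) (dyadicRadius j * fourier 1 t)))

theorem exists_radialMin_eq (a : ℝ) (J : ℕ) (t : UnitAddCircle) : ∃ j : Fin (J + 1),
    radialMin a J t =
      Real.exp (-(a * herglotzRe (dyadicRadius J) (dyadicRadius j * fourier 1 t))) := by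
  obtain ⟨j, hj, h⟩ := Finset.exists_mem_eq_inf' (Finset.nonempty_range_add_one (n := J)) fun j =>
    Real.exp (-(a * herglotzRe (dyadicRadius J) (dyadicRadius j * fourier 1 t)))
  exact ⟨⟨j, Finset.mem_range.1 hj⟩, h⟩

theorem radialMin_pos (a : ℝ) (J : ℕ) (t : UnitAddCircle) : 0 < radialMin a J t := by
  obtain ⟨j, h⟩ := exists_radialMin_eq a J t
  rw [h]; exact Real.exp_pos _

theorem radialMin_le (a : ℝ) {J j : ℕ} (hj : j ≤ J) (t : UnitAddCircle) : radialMin a J t ≤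
    Real.exp (-(a * herglotzRe (dyadicRadius J) (dyadicRadius j * fourier 1 t))) :=
  Finset.inf'_le _ (Finset.mem_range.2 (Nat.lt_succ_of_le hj))

theorem radialMin_le_one {a : ℝ} (ha : 0 ≤ a) (J : ℕ) (t : UnitAddCircle) :
    radialMin a J t ≤ 1 := by
  refine (radialMin_le a (Nat.zero_le J) t).trans (Real.exp_le_one_iff.2 ?_)
  have := mul_nonneg ha (herglotzRe_nonneg (dyadicRadius_nonneg J) (dyadicRadius_lt_one J)
    (norm_dyadicRadius_mul_fourier_le 0 t))
  linarith

theorem continuous_radialMin (a : ℝ) (J : ℕ) : Continuous (radialMin a J) := by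
  refine Continuous.finset_inf'_apply _ fun j _ => ?_
  have := continuous_comp_circle (continuousOn_herglotz (dyadicRadius_nonneg J)
    (dyadicRadius_lt_one J)) (dyadicRadius_nonneg j) (dyadicRadius_lt_one j).le
  unfold herglotzRe
  fun_prop

/-- The gain of the factor `J + 1` over the mean of the kernel at a fixed radius is what drives the
construction. The condition `a * 2 ^ J ≤ 1` keeps the exponent `x` in `[0, 1]`, where `exp (-x) ≤ 1
/ (1 + x) ≤ 1 - x / 2`. -/
theorem integral_radialMin_le {a : ℝ} {J : ℕ} (ha : 0 ≤ a) (haJ : a * 2 ^ J ≤ 1) :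
    ∫ t, radialMin a J t ∂AddCircle.haarAddCircle ≤ 1 - a / 324 * (J + 1) := by
  have := integral_le_of_le_on_dyadic_balls (continuous_radialMin a J) (radialMin_le_one ha J)
    (c := a / 162) (by positivity) J ?_
  · convert! this using 3; ring
  intro j hj t ht
  refine (radialMin_le a hj t).trans ?_
  have h1 : a * (2 ^ j / 81) ≤ a * herglotzRe (dyadicRadius J) (dyadicRadius j * fourier 1 t) :=
    mul_le_mul_of_nonneg_left (le_herglotzRe_dyadicRadius hj ht) ha
  set x := a * (2 ^ j / 81) with hx
  have hx0 : 0 ≤ x := by positivity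
  have hx1 : x ≤ 1 := by
    have : a * 2 ^ j ≤ a * 2 ^ J :=
      mul_le_mul_of_nonneg_left (pow_le_pow_right₀ (by norm_num) hj) ha
    rw [hx]; linarith
  refine (Real.exp_le_exp.2 (neg_le_neg h1)).trans ?_
  have h2 : Real.exp (-x) ≤ 1 / (1 + x) := by
    rw [Real.exp_neg, one_div]
    exact inv_anti₀ (by linarith) (by linarith [Real.add_one_le_exp x])
  refine h2.trans ?_
  rw [div_le_iff₀ (by linarith), show a / 162 * 2 ^ j = x / 2 by rw [hx]; ring]
  nlinarith

/-! ### Weights and the infinite product -/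

/-- Weights `a` and levels `J` for which `∑ a n` converges while `∑ a n * (J n + 1)` diverges. -/
structure IsAdmissible (a : ℕ → ℝ) (J : ℕ → ℕ) : Prop where
  nonneg : ∀ n, 0 ≤ a n
  mul_le : ∀ n, a n * 2 ^ J n ≤ 1
  summable : Summable a
  not_summable : ¬ Summable fun n => a n / 324 * (J n + 1)

/-- Cauchy condensation compares the two series, for `a_n = 1 / ((n + 1)(log₂ n + 1)²)` and `J_n =
⌊log₂ n⌋`, with `∑ 1 / (k + 1)²` and `∑ 1 / (k + 1)`. -/
theorem exists_isAdmissible : ∃ a J, IsAdmissible a J := by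
  refine ⟨fun n => 1 / (((n : ℝ) + 1) * (Nat.log 2 n + 1) ^ 2), fun n => Nat.log 2 n,
    fun n => by positivity, fun n => ?_, ?_, ?_⟩
  · have h1 : (2 : ℝ) ^ Nat.log 2 n ≤ n + 1 := by
      rcases Nat.eq_zero_or_pos n with rfl | hn
      · simp
      · have := Nat.pow_log_le_self 2 hn.ne'
        have : (2 : ℝ) ^ Nat.log 2 n ≤ n := by exact_mod_cast this
        linarith
    rw [one_div_mul_eq_div, div_le_one (by positivity)]
    refine h1.trans (le_mul_of_one_le_right (by positivity) (one_le_pow₀ ?_))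
    linarith [(Nat.log 2 n).cast_nonneg (α := ℝ)]
  · rw [← summable_condensed_iff_of_nonneg (fun n => by positivity)]
    · have h : Summable fun k : ℕ => 1 / ((k : ℝ) + 1) ^ 2 := by
        have := (summable_nat_add_iff 1).2 (Real.summable_one_div_nat_pow.2 one_lt_two)
        simpa using this
      refine h.of_nonneg_of_le (fun k => by positivity) fun k => ?_
      rw [Nat.log_pow one_lt_two, mul_one_div]
      push_cast
      rw [div_le_div_iff₀ (by positivity) (by positivity)]
      have : (0 : ℝ) < (k + 1) ^ 2 := by positivity
      nlinarith
    · intro m n _ hmn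
      have h1 : (Nat.log 2 m : ℝ) ≤ Nat.log 2 n := by exact_mod_cast Nat.log_mono_right hmn
      have h2 : (m : ℝ) ≤ n := by exact_mod_cast hmn
      gcongr
  · intro h
    have h' : Summable fun n : ℕ => 1 / (((n : ℝ) + 1) * (Nat.log 2 n + 1)) := by
      refine (h.mul_left 324).congr fun n => ?_
      field_simp
    rw [← summable_condensed_iff_of_nonneg (fun n => by positivity)] at h'
    · have h2 : Summable fun k : ℕ => 1 / ((k + 1 : ℕ) : ℝ) := by
        refine (h'.mul_left 2).of_nonneg_of_le (fun k => by positivity) fun k => ?_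
        rw [Nat.log_pow one_lt_two, mul_one_div, mul_div_assoc']
        push_cast
        rw [div_le_div_iff₀ (by positivity) (by positivity)]
        have : (1 : ℝ) ≤ 2 ^ k := one_le_pow₀ (by norm_num)
        have : (0 : ℝ) < k + 1 := by positivity
        nlinarith
      exact Real.not_summable_one_div_natCast
        ((summable_nat_add_iff (f := fun k : ℕ => 1 / (k : ℝ)) 1).1 h2)
    · intro m n _ hmn
      have h1 : (Nat.log 2 m : ℝ) ≤ Nat.log 2 n := by exact_mod_cast Nat.log_mono_right hmn
      have h2 : (m : ℝ) ≤ n := by exact_mod_cast hmn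
      gcongr

/-- The zero-free function `exp (-∑ a_n ((1 + s_n z_n) / (1 - s_n z_n) - 1))` on `𝔻^∞ ∩ c₀`. -/
noncomputable def herglotzProduct (a : ℕ → ℝ) (J : ℕ → ℕ) (z : ℕ → ℂ) : ℂ :=
  Complex.exp (-∑' n, (a n : ℂ) * herglotz (dyadicRadius (J n)) (z n))

/-- The boundary function of the `m`-th partial product of `herglotzProduct`. -/
noncomputable def partialProduct (a : ℕ → ℝ) (J : ℕ → ℕ) (m : ℕ) (θ : UnitAddTorus ℕ) : ℂ :=
  ∏ n ∈ Finset.range m, herglotzExp (a n) (dyadicRadius (J n)) (fourier 1 (θ n))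

variable {a : ℕ → ℝ} {J : ℕ → ℕ}

theorem IsAdmissible.summable_herglotz (h : IsAdmissible a J) {z : ℕ → ℂ} (hz : z ∈ polydiscC0) :
    Summable fun n => (a n : ℂ) * herglotz (dyadicRadius (J n)) (z n) := by
  refine Summable.of_norm_bounded_eventually_nat (h.summable.mul_right 2) ?_
  filter_upwards [hz.2.norm.eventually_le_const (u := 1 / 2) (by simp)] with n hn
  rw [norm_mul, Complex.norm_real, Real.norm_of_nonneg (h.nonneg n)]
  exact mul_le_mul_of_nonneg_left
    (norm_herglotz_le (dyadicRadius_nonneg _) (dyadicRadius_lt_one _) hn) (h.nonneg n)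

theorem exp_neg_sum_herglotz (s : Finset ℕ) (z : ℕ → ℂ) :
    Complex.exp (-∑ n ∈ s, (a n : ℂ) * herglotz (dyadicRadius (J n)) (z n)) =
      ∏ n ∈ s, herglotzExp (a n) (dyadicRadius (J n)) (z n) := by
  rw [← Finset.sum_neg_distrib, Complex.exp_sum]; rfl

theorem herglotzProduct_eq_prod {z : ℕ → ℂ} {m : ℕ} (hz : ∀ n, m ≤ n → z n = 0) :
    herglotzProduct a J z =
      ∏ n ∈ Finset.range m, herglotzExp (a n) (dyadicRadius (J n)) (z n) := by
  rw [← exp_neg_sum_herglotz, herglotzProduct, tsum_eq_sum (s := Finset.range m)]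
  intro n hn
  rw [hz n (by simpa using hn), herglotz_zero, mul_zero]

theorem IsAdmissible.tendsto_prod (h : IsAdmissible a J) {z : ℕ → ℂ} (hz : z ∈ polydiscC0) :
    Tendsto (fun m => ∏ n ∈ Finset.range m, herglotzExp (a n) (dyadicRadius (J n)) (z n)) atTop
      (𝓝 (herglotzProduct a J z)) := by
  simp_rw [← exp_neg_sum_herglotz]
  exact (h.summable_herglotz hz).hasSum.tendsto_sum_nat.neg.cexp

/-- The modulus is exactly `exp (∑ a_n)` times the product of all the decaying factors; those
outside `s` are at most 1 and may be dropped. -/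
theorem IsAdmissible.norm_herglotzProduct_le (h : IsAdmissible a J) {z : ℕ → ℂ}
    (hz : z ∈ polydiscC0) (s : Finset ℕ) :
    ‖herglotzProduct a J z‖ ≤ Real.exp (∑' n, a n) *
      ∏ n ∈ s, Real.exp (-(a n * herglotzRe (dyadicRadius (J n)) (z n))) := by
  have hs := h.summable_herglotz hz
  have h1 : ∀ n, 0 ≤ a n * herglotzRe (dyadicRadius (J n)) (z n) := fun n =>
    mul_nonneg (h.nonneg n)
      (herglotzRe_nonneg (dyadicRadius_nonneg _) (dyadicRadius_lt_one _) (hz.1 n).le)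
  have h2 : HasSum (fun n => a n * herglotzRe (dyadicRadius (J n)) (z n))
      (∑' n, a n + (∑' n, (a n : ℂ) * herglotz (dyadicRadius (J n)) (z n)).re) := by
    refine (h.summable.hasSum.add (Complex.hasSum_re hs.hasSum)).congr_fun fun n => ?_
    simp [herglotzRe]; ring
  have h3 := sum_le_hasSum s (fun n _ => h1 n) h2
  rw [herglotzProduct, Complex.norm_exp, ← Real.exp_sum, ← Real.exp_add, Real.exp_le_exp,
    Finset.sum_neg_distrib, Complex.neg_re]
  linarith

/-! ### Boundary function and its Fourier coefficients -/

theorem norm_fourier_le_one (t : UnitAddCircle) : ‖(fourier 1 t : ℂ)‖ ≤ 1 :=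
  (norm_fourier_apply 1 t).le

theorem continuous_herglotzExp_fourier (a : ℝ) (J : ℕ) :
    Continuous fun t : UnitAddCircle => herglotzExp a (dyadicRadius J) (fourier 1 t) := by
  simpa using continuous_comp_circle (continuousOn_herglotzExp a (dyadicRadius_nonneg J)
    (dyadicRadius_lt_one J)) zero_le_one le_rfl

theorem measurable_partialProduct (m : ℕ) : Measurable (partialProduct a J m) :=
  Finset.measurable_fun_prod _ fun n _ =>
    (continuous_herglotzExp_fourier (a n) (J n)).measurable.comp (measurable_pi_apply n)

theorem IsAdmissible.norm_partialProduct_le (h : IsAdmissible a J) (m : ℕ) (θ : UnitAddTorus ℕ) :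
    ‖partialProduct a J m θ‖ ≤ Real.exp (∑' n, a n) := by
  rw [partialProduct, norm_prod]
  calc _ ≤ ∏ n ∈ Finset.range m, Real.exp (a n) :=
        Finset.prod_le_prod (fun _ _ => norm_nonneg _) fun n _ => norm_herglotzExp_le (h.nonneg n)
          (dyadicRadius_nonneg _) (dyadicRadius_lt_one _) (norm_fourier_le_one _)
    _ ≤ _ := by
        rw [← Real.exp_sum, Real.exp_le_exp]
        exact h.summable.sum_le_tsum _ fun n _ => h.nonneg n

theorem integral_herglotzExp_fourier (a : ℝ) (J : ℕ) :
    ∫ t : UnitAddCircle, herglotzExp a (dyadicRadius J) (fourier 1 t) ∂AddCircle.haarAddCircle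
      = 1 := by
  obtain ⟨c, -, h0, -, h⟩ := exists_taylor_fourier
    (one_lt_two_div_one_add (dyadicRadius_nonneg J) (dyadicRadius_lt_one J))
    (differentiableOn_herglotzExp a (dyadicRadius_nonneg J) (dyadicRadius_lt_one J))
  simpa [h0] using h 0

theorem integral_herglotzRe_fourier (J : ℕ) :
    ∫ t : UnitAddCircle, herglotzRe (dyadicRadius J) (fourier 1 t) ∂AddCircle.haarAddCircle
      = 1 := by
  obtain ⟨c, -, h0, -, h⟩ := exists_taylor_fourier
    (one_lt_two_div_one_add (dyadicRadius_nonneg J) (dyadicRadius_lt_one J))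
    (differentiableOn_herglotz (dyadicRadius_nonneg J) (dyadicRadius_lt_one J))
  have h1 : ∫ t : UnitAddCircle, herglotz (dyadicRadius J) (fourier 1 t) ∂AddCircle.haarAddCircle
      = 0 := by simpa [h0] using h 0
  have h2 : Integrable (fun t : UnitAddCircle => herglotz (dyadicRadius J) (fourier 1 t))
      AddCircle.haarAddCircle := by
    have : Continuous fun t : UnitAddCircle => herglotz (dyadicRadius J) (fourier 1 t) := by
      simpa using continuous_comp_circle (continuousOn_herglotz (dyadicRadius_nonneg J)
        (dyadicRadius_lt_one J)) zero_le_one le_rfl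
    exact this.integrable_of_hasCompactSupport (HasCompactSupport.of_compactSpace _)
  unfold herglotzRe
  have h3 := integral_re h2
  simp only [RCLike.re_to_complex] at h3
  rw [integral_add (integrable_const _) (by simpa using h2.re), h3, h1]
  simp

theorem integrable_herglotzRe_fourier (J : ℕ) :
    Integrable (fun t : UnitAddCircle => herglotzRe (dyadicRadius J) (fourier 1 t))
      AddCircle.haarAddCircle := by
  by_contra h
  -- A non-integrable function has integral 0 by convention, while this integral is 1.
  exact zero_ne_one ((integral_undef h).symm.trans (integral_herglotzRe_fourier J))

theorem measurePreserving_torus_eval (n : ℕ) :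
    MeasurePreserving (fun θ : UnitAddTorus ℕ => θ n) torusMeasure AddCircle.haarAddCircle :=
  measurePreserving_eval_infinitePi (fun _ : ℕ => AddCircle.haarAddCircle) n

theorem integrable_torus_eval {g : UnitAddCircle → ℝ} (hg : Integrable g AddCircle.haarAddCircle)
    (n : ℕ) : Integrable (fun θ : UnitAddTorus ℕ => g (θ n)) torusMeasure :=
  (measurePreserving_torus_eval n).integrable_comp_of_integrable hg

theorem integral_torus_eval {g : UnitAddCircle → ℝ} (hg : Integrable g AddCircle.haarAddCircle)
    (n : ℕ) : ∫ θ : UnitAddTorus ℕ, g (θ n) ∂torusMeasure = ∫ t, g t ∂AddCircle.haarAddCircle := by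
  have h := (measurePreserving_torus_eval n).map_eq
  rw [← h] at hg
  have h1 := integral_map (measurePreserving_torus_eval n).aemeasurable hg.1
  rw [h] at h1
  exact h1.symm

theorem IsAdmissible.ae_summable (h : IsAdmissible a J) : ∀ᵐ θ ∂torusMeasure,
    Summable fun n => a n * herglotzRe (dyadicRadius (J n)) (fourier 1 (θ n)) := by
  set g : ℕ → UnitAddCircle → ℝ := fun n t => a n * herglotzRe (dyadicRadius (J n)) (fourier 1 t)
    with hg
  have hi : ∀ n, Integrable (g n) AddCircle.haarAddCircle := fun n =>
    (integrable_herglotzRe_fourier (J n)).const_mul _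
  have h0 : ∀ n t, 0 ≤ g n t := fun n t => mul_nonneg (h.nonneg n)
    (herglotzRe_nonneg (dyadicRadius_nonneg _) (dyadicRadius_lt_one _) (norm_fourier_le_one _))
  have h1 : ∀ n, ∫ t, g n t ∂AddCircle.haarAddCircle = a n := fun n => by
    rw [hg, integral_const_mul, integral_herglotzRe_fourier, mul_one]
  refine ae_summable_of_summable_integral (X := fun n (θ : UnitAddTorus ℕ) => g n (θ n))
    (fun n θ => h0 n _) (fun n => integrable_torus_eval (hi n) n) ?_
  exact h.summable.congr fun n => by rw [integral_torus_eval (hi n) n, h1]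

/-- This bound is uniform in `m`, so it passes to the limit and shows that the boundary function is
nonzero. -/
theorem IsAdmissible.le_norm_partialProduct (h : IsAdmissible a J) {θ : UnitAddTorus ℕ}
    (hθ : Summable fun n => a n * herglotzRe (dyadicRadius (J n)) (fourier 1 (θ n))) (m : ℕ) :
    Real.exp (-∑' n, a n * herglotzRe (dyadicRadius (J n)) (fourier 1 (θ n))) ≤
      ‖partialProduct a J m θ‖ := by
  rw [partialProduct, norm_prod]
  simp_rw [norm_herglotzExp, ← Real.exp_add]
  rw [← Real.exp_sum, Real.exp_le_exp, Finset.sum_add_distrib, Finset.sum_neg_distrib]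
  have h1 := hθ.sum_le_tsum (Finset.range m) fun n _ => mul_nonneg (h.nonneg n)
    (herglotzRe_nonneg (dyadicRadius_nonneg _) (dyadicRadius_lt_one _) (norm_fourier_le_one (θ n)))
  have h2 := Finset.sum_nonneg fun n (_ : n ∈ Finset.range m) => h.nonneg n
  linarith

/-- The `k` additional factors are independent of the others and have mean 1, so the result does not
depend on `k`: the partial products form a martingale. -/
theorem integral_partialProduct_mul_conj (m k : ℕ) :
    ∫ θ, partialProduct a J (m + k) θ * (starRingEnd ℂ) (partialProduct a J m θ) ∂torusMeasure =
      ∏ n ∈ Finset.range m, ∫ t : UnitAddCircle,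
        herglotzExp (a n) (dyadicRadius (J n)) (fourier 1 t) *
          (starRingEnd ℂ) (herglotzExp (a n) (dyadicRadius (J n)) (fourier 1 t))
          ∂AddCircle.haarAddCircle := by
  have hm := fun n => (continuous_herglotzExp_fourier (a n) (J n))
  set w : ℕ → UnitAddCircle → ℂ := fun n t =>
    herglotzExp (a n) (dyadicRadius (J n)) (fourier 1 t) *
      if n < m then (starRingEnd ℂ) (herglotzExp (a n) (dyadicRadius (J n)) (fourier 1 t)) else 1
    with hw
  have h1 : ∀ θ : UnitAddTorus ℕ,
      partialProduct a J (m + k) θ * (starRingEnd ℂ) (partialProduct a J m θ) =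
        ∏ n ∈ Finset.range (m + k), w n (θ n) := by
    intro θ
    simp only [hw, partialProduct, Finset.prod_mul_distrib]
    congr 1
    rw [map_prod, Finset.prod_range_add, Finset.prod_congr rfl fun n hn => if_pos (by simpa using hn)]
    simp
  simp_rw [h1]
  rw [integral_prod_torus, Finset.prod_range_add]
  · have h2 : ∀ x, ∫ t, w (m + x) t ∂AddCircle.haarAddCircle = 1 := by
      intro x
      simp only [hw, if_neg (Nat.not_lt.2 (Nat.le_add_right m x)), mul_one]
      exact integral_herglotzExp_fourier _ _
    simp only [h2, Finset.prod_const_one, mul_one]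
    refine Finset.prod_congr rfl fun n hn => ?_
    simp only [hw, if_pos (Finset.mem_range.1 hn)]
  · intro n _
    refine (hm n).measurable.mul ?_
    split_ifs
    · exact (Complex.continuous_conj.comp (hm n)).measurable
    · exact measurable_const

/-- The partial products converge almost everywhere along a subsequence. -/
theorem IsAdmissible.exists_boundary_function (h : IsAdmissible a J) :
    ∃ (f : UnitAddTorus ℕ → ℂ) (φ : ℕ → ℕ), AEStronglyMeasurable f torusMeasure ∧
      StrictMono φ ∧
      ∀ᵐ θ ∂torusMeasure, Tendsto (fun i => partialProduct a J (φ i) θ) atTop (𝓝 (f θ)) := by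
  have hL : ∀ m, MemLp (partialProduct a J m) 2 torusMeasure := fun m =>
    MemLp.of_bound (measurable_partialProduct m).aestronglyMeasurable _
      (ae_of_all _ (h.norm_partialProduct_le m))
  set V : ℕ → Lp ℂ 2 torusMeasure := fun m => (hL m).toLp with hV
  have hin : ∀ m k, inner ℂ (V m) (V (m + k)) = ∫ θ, partialProduct a J (m + k) θ *
      (starRingEnd ℂ) (partialProduct a J m θ) ∂torusMeasure := by
    intro m k
    rw [L2.inner_def]
    refine integral_congr_ae ?_
    filter_upwards [(hL m).coeFn_toLp, (hL (m + k)).coeFn_toLp] with θ h1 h2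
    rw [h1, h2, RCLike.inner_apply]
  have hin' : ∀ m k, inner ℂ (V m) (V (m + k)) = inner ℂ (V m) (V m) := by
    intro m k
    have := hin m 0
    rw [add_zero] at this
    rw [hin m k, this, integral_partialProduct_mul_conj]
    exact (integral_partialProduct_mul_conj m 0).symm
  -- Pythagoras for orthogonal increments: the bounded increasing norms force `V` to be Cauchy in
  -- `L²`.
  have hdist : ∀ m k, ‖V (m + k) - V m‖ ^ 2 = ‖V (m + k)‖ ^ 2 - ‖V m‖ ^ 2 := by
    intro m k
    rw [@norm_sub_sq ℂ, ← inner_conj_symm, hin', RCLike.conj_re, inner_self_eq_norm_sq]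
    ring
  have hbdd : ∀ m, ‖V m‖ ≤ Real.exp (∑' n, a n) := by
    intro m
    refine (Lp.norm_le_of_ae_bound (Real.exp_pos _).le (C := Real.exp (∑' n, a n)) ?_).trans ?_
    · filter_upwards [(hL m).coeFn_toLp] with θ h1
      rw [h1]; exact h.norm_partialProduct_le m θ
    · simp [measureUnivNNReal]
  have hmono : Monotone fun m => ‖V m‖ ^ 2 := by
    refine monotone_nat_of_le_succ fun m => ?_
    have := hdist m 1
    nlinarith [sq_nonneg ‖V (m + 1) - V m‖]
  have hconv := tendsto_atTop_ciSup hmono ⟨Real.exp (∑' n, a n) ^ 2, by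
    rintro _ ⟨m, rfl⟩
    exact pow_le_pow_left₀ (norm_nonneg _) (hbdd m) 2⟩
  have hcauchy : CauchySeq V := by
    rw [Metric.cauchySeq_iff']
    intro ε hε
    obtain ⟨N, hN⟩ := Metric.cauchySeq_iff'.1 hconv.cauchySeq (ε ^ 2) (by positivity)
    refine ⟨N, fun n hn => ?_⟩
    obtain ⟨k, rfl⟩ := Nat.exists_eq_add_of_le hn
    have h1 := hN (N + k) hn
    rw [Real.dist_eq] at h1
    rw [dist_eq_norm]
    refine lt_of_pow_lt_pow_left₀ 2 hε.le ?_
    rw [hdist]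
    exact (le_abs_self _).trans_lt h1
  obtain ⟨g, hg⟩ := cauchySeq_tendsto_of_complete hcauchy
  obtain ⟨φ, hφ, hφ'⟩ := (tendstoInMeasure_of_tendsto_Lp hg).exists_seq_tendsto_ae
  refine ⟨g, φ, Lp.aestronglyMeasurable g, hφ, ?_⟩
  have hall : ∀ᵐ θ ∂torusMeasure, ∀ m, V m θ = partialProduct a J m θ :=
    ae_all_iff.2 fun m => (hL m).coeFn_toLp
  filter_upwards [hφ', hall] with θ h1 h2
  simpa only [h2] using h1

/-- A sequence of partial products converging boundedly defines a function in `H^∞` whose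
extension to `𝔻^∞ ∩ c₀` is `herglotzProduct`. -/
theorem IsAdmissible.memHardy_and_extension (h : IsAdmissible a J) {f : UnitAddTorus ℕ → ℂ}
    {φ : ℕ → ℕ} (hf : AEStronglyMeasurable f torusMeasure) (hφ : StrictMono φ)
    (hlim : ∀ᵐ θ ∂torusMeasure, Tendsto (fun i => partialProduct a J (φ i) θ) atTop (𝓝 (f θ))) :
    MemHardy ∞ f ∧ IsPolydiscExtension f (herglotzProduct a J) := by
  choose c hcs hc0 hcz hcj using fun n => exists_taylor_fourier
    (one_lt_two_div_one_add (dyadicRadius_nonneg (J n)) (dyadicRadius_lt_one (J n)))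
    (differentiableOn_herglotzExp (a n) (dyadicRadius_nonneg (J n)) (dyadicRadius_lt_one (J n)))
  set d : ℕ → ℤ → ℂ := fun n j => if 0 ≤ j then c n j.toNat else 0 with hd
  -- Each factor equals 1 at the origin, so variables outside the support of `ν` do not affect the
  -- coefficient, and it stabilises in `m`.
  have hd0 : ∀ n, d n 0 = 1 := fun n => by simp [hd, hc0]
  have hchar : ∀ (ν : ℕ →₀ ℤ) (m : ℕ), ν.support ⊆ Finset.range m → ∀ θ, torusChar (-ν) θ =
      ∏ n ∈ Finset.range m, fourier (-ν n) (θ n) := by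
    intro ν m hν θ
    exact Finsupp.prod_of_support_subset (-ν) (by rwa [Finsupp.support_neg])
      (fun n (k : ℤ) => (fourier k (θ n) : ℂ)) fun n _ => fourier_zero
  have hcont : ∀ n (j : ℤ), Continuous fun t : UnitAddCircle =>
      fourier (-j) t * herglotzExp (a n) (dyadicRadius (J n)) (fourier 1 t) := fun n j =>
    (map_continuous (fourier (-j))).mul (continuous_herglotzExp_fourier (a n) (J n))
  have hpart : ∀ (ν : ℕ →₀ ℤ) (m : ℕ), ν.support ⊆ Finset.range m →
      torusCoeff (partialProduct a J m) ν = ∏ n ∈ Finset.range m, d n (ν n) := by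
    intro ν m hν
    rw [torusCoeff]
    simp_rw [hchar ν m hν, partialProduct, ← Finset.prod_mul_distrib]
    rw [integral_prod_torus (Finset.range m) (fun n t => fourier (-ν n) t *
      herglotzExp (a n) (dyadicRadius (J n)) (fourier 1 t)) fun n _ => (hcont n _).measurable]
    exact Finset.prod_congr rfl fun n _ => hcj n (ν n)
  have hprod : ∀ (ν : ℕ →₀ ℤ) (m m' : ℕ), ν.support ⊆ Finset.range m → m ≤ m' →
      ∏ n ∈ Finset.range m', d n (ν n) = ∏ n ∈ Finset.range m, d n (ν n) := by
    intro ν m m' hν hm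
    refine (Finset.prod_subset (Finset.range_mono hm) fun n _ hn => ?_).symm
    rw [Finsupp.notMem_support_iff.1 fun h' => hn (hν h'), hd0]
  have hcoeff : ∀ (ν : ℕ →₀ ℤ) (m : ℕ), ν.support ⊆ Finset.range m →
      torusCoeff f ν = ∏ n ∈ Finset.range m, d n (ν n) := by
    intro ν m hν
    have hcm : Measurable (torusChar (-ν)) := by
      rw [funext (hchar ν m hν)]
      exact Finset.measurable_fun_prod _ fun n _ =>
        (map_continuous (fourier (-ν n))).measurable.comp (measurable_pi_apply n)
    have h1 : Tendsto (fun i => torusCoeff (partialProduct a J (φ i)) ν) atTop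
        (𝓝 (torusCoeff f ν)) := by
      refine tendsto_integral_filter_of_norm_le_const (Eventually.of_forall fun i =>
        (hcm.mul (measurable_partialProduct _)).aestronglyMeasurable)
        ⟨Real.exp (∑' n, a n), Eventually.of_forall fun i => ae_of_all _ fun θ => ?_⟩ ?_
      · rw [norm_mul, hchar ν m hν, norm_prod]
        simp_rw [norm_fourier_apply]
        simpa using h.norm_partialProduct_le (φ i) θ
      · filter_upwards [hlim] with θ hθ using hθ.const_mul _
    refine tendsto_nhds_unique h1 (tendsto_const_nhds.congr' ?_)
    filter_upwards [hφ.tendsto_atTop.eventually_ge_atTop m] with i hi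
    rw [hpart ν (φ i) (hν.trans (Finset.range_mono hi)), hprod ν m (φ i) hν hi]
  have hsub : ∀ ν : ℕ →₀ ℤ, ∃ m, ν.support ⊆ Finset.range m := fun ν =>
    Finset.exists_nat_subset_range _
  refine ⟨⟨MemLp.of_bound hf (Real.exp (∑' n, a n)) ?_, ?_⟩, ?_⟩
  · filter_upwards [hlim] with θ hθ
    exact le_of_tendsto hθ.norm (Eventually.of_forall fun i => h.norm_partialProduct_le _ θ)
  · rintro ν ⟨n, hn⟩
    obtain ⟨m, hm⟩ := hsub ν
    rw [hcoeff ν m hm]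
    refine Finset.prod_eq_zero (i := n) (hm (Finsupp.mem_support_iff.2 hn.ne)) ?_
    simp [hd, hn]
  · intro z hz
    refine ⟨_, fun m => ?_, h.tendsto_prod hz⟩
    have := (hasSum_prod_finsupp (b := fun n k => c n k * z n ^ k) (fun n => hcz n (z n) (hz.1 n).le)
      (fun n => (hcs n).of_nonneg_of_le (fun k => norm_nonneg _) fun k => by
        rw [norm_mul, norm_pow]
        exact mul_le_of_le_one_right (norm_nonneg _)
          (pow_le_one₀ (norm_nonneg _) (hz.1 n).le)) m).1
    refine this.congr_fun fun ν => ?_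
    rw [hcoeff _ m (Finsupp.support_mapRange.trans ν.2),
      Finsupp.prod_of_support_subset _ ν.2 _ fun n _ => pow_zero _, ← Finset.prod_mul_distrib]
    simp [hd]

/-! ### Blocks of variables with small radial minima -/

theorem IsAdmissible.exists_prod_integral_radialMin_le (h : IsAdmissible a J) (m : ℕ) {ε : ℝ}
    (hε : 0 < ε) : ∃ M, m < M ∧
      ∏ n ∈ Finset.Ico m M, ∫ t, radialMin (a n) (J n) t ∂AddCircle.haarAddCircle ≤ ε := by
  have hb : ∀ n, 0 ≤ a n / 324 * (J n + 1) := fun n => by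
    have := h.nonneg n
    positivity
  have ht := (not_summable_iff_tendsto_nat_atTop_of_nonneg hb).1 h.not_summable
  obtain ⟨M, hM1, hM2⟩ := ((ht.eventually_ge_atTop
    (∑ n ∈ Finset.range m, a n / 324 * (J n + 1) - Real.log ε)).and (eventually_gt_atTop m)).exists
  refine ⟨M, hM2, ?_⟩
  calc _ ≤ ∏ n ∈ Finset.Ico m M, Real.exp (-(a n / 324 * (J n + 1))) :=
        Finset.prod_le_prod (fun n _ => integral_nonneg fun t => (radialMin_pos _ _ t).le)
          fun n _ => (integral_radialMin_le (h.nonneg n) (h.mul_le n)).trans <| by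
            linarith [Real.add_one_le_exp (-(a n / 324 * (J n + 1)))]
    _ ≤ Real.exp (Real.log ε) := by
        rw [← Real.exp_sum, Real.exp_le_exp, Finset.sum_neg_distrib,
          Finset.sum_Ico_eq_sub _ hM2.le]
        linarith
    _ = ε := Real.exp_log hε

/-- There are consecutive blocks of variables over which the products of the radial minima tend
to `0` almost everywhere. -/
theorem IsAdmissible.exists_blocks (h : IsAdmissible a J) : ∃ N : ℕ → ℕ, StrictMono N ∧
    ∀ᵐ θ ∂torusMeasure, Tendsto
      (fun k => ∏ n ∈ Finset.Ico (N k) (N (k + 1)), radialMin (a n) (J n) (θ n)) atTop (𝓝 0) := by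
  choose g hg1 hg2 using fun m k : ℕ =>
    h.exists_prod_integral_radialMin_le m (ε := (1 / 2) ^ k) (by positivity)
  let N : ℕ → ℕ := fun k => Nat.rec 0 (fun k m => g m k) k
  have hN : ∀ k, N (k + 1) = g (N k) k := fun k => rfl
  refine ⟨N, strictMono_nat_of_lt_succ fun k => hg1 (N k) k, ?_⟩
  have hmeas : ∀ n, Measurable (radialMin (a n) (J n)) := fun n => (continuous_radialMin _ _).measurable
  have hmeas' : ∀ k, Measurable fun θ : UnitAddTorus ℕ =>
      ∏ n ∈ Finset.Ico (N k) (N (k + 1)), radialMin (a n) (J n) (θ n) := fun k =>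
    Finset.measurable_fun_prod _ fun n _ => (hmeas n).comp (measurable_pi_apply n)
  have h0 : ∀ k (θ : UnitAddTorus ℕ),
      0 ≤ ∏ n ∈ Finset.Ico (N k) (N (k + 1)), radialMin (a n) (J n) (θ n) := fun k θ =>
    Finset.prod_nonneg fun n _ => (radialMin_pos _ _ _).le
  -- By independence the `k`-th block product has mean at most `2^(-k)`; hence almost surely the
  -- block products are summable, and so tend to 0.
  have hs := ae_summable_of_summable_integral (μ := torusMeasure)
    (X := fun k θ => ∏ n ∈ Finset.Ico (N k) (N (k + 1)), radialMin (a n) (J n) (θ n)) h0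
    (fun k => Integrable.of_bound (hmeas' k).aestronglyMeasurable 1 (ae_of_all _ fun θ => by
      rw [Real.norm_of_nonneg (h0 k θ)]
      exact Finset.prod_le_one (fun n _ => (radialMin_pos _ _ _).le)
        fun n _ => radialMin_le_one (h.nonneg n) _ _))
    (by
      refine summable_geometric_two.of_nonneg_of_le (fun k => integral_nonneg (h0 k)) fun k => ?_
      rw [integral_prod_torus _ (fun n => radialMin (a n) (J n)) fun n _ => hmeas n]
      exact hg2 (N k) k)
  filter_upwards [hs] with θ hθ using hθ.tendsto_atTop_zero

/-! ### Radial approaches built from blocks -/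

theorem dyadicRadius_mono : Monotone dyadicRadius := fun i j hij => by
  have : (1 / 2 : ℝ) ^ j ≤ (1 / 2) ^ i := pow_le_pow_of_le_one (by norm_num) (by norm_num) hij
  unfold dyadicRadius; linarith

theorem tendsto_dyadicRadius : Tendsto dyadicRadius atTop (𝓝 1) := by
  have := (tendsto_pow_atTop_nhds_zero_of_lt_one (r := (1 / 2 : ℝ)) (by norm_num)
    (by norm_num)).const_sub 1
  rwa [sub_zero] at this

/-- Radii that are at least `1 - 2⁻ᵏ` before the `k`-th block, dyadic of the prescribed levels on
this block, and `0` after it. -/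
noncomputable def blockRadii (N : ℕ → ℕ) (k : ℕ) (l : ℕ → ℕ) (n : ℕ) : ℝ :=
  if n < N k then dyadicRadius (max (l n) k) else if n < N (k + 1) then dyadicRadius (l n) else 0

theorem isRadialApproach_blockRadii {N : ℕ → ℕ} (hN : StrictMono N) {κ : ℕ → ℕ}
    (hκ : Tendsto κ atTop atTop) (l : ℕ → ℕ → ℕ) :
    IsRadialApproach fun i => blockRadii N (κ i) (l i) where
  nonneg i n := by
    unfold blockRadii
    split_ifs <;> first | exact dyadicRadius_nonneg _ | exact le_rfl
  lt_one i n := by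
    unfold blockRadii
    split_ifs <;> first | exact dyadicRadius_lt_one _ | exact zero_lt_one
  tendsto_zero i := by
    refine tendsto_const_nhds.congr' ?_
    filter_upwards [eventually_ge_atTop (N (κ i + 1))] with n hn
    have := hN (Nat.lt_add_one (κ i))
    rw [blockRadii, if_neg (by omega), if_neg (by omega)]
  tendsto_one n := by
    refine tendsto_of_tendsto_of_tendsto_of_le_of_le' (tendsto_dyadicRadius.comp hκ)
      tendsto_const_nhds ?_ ?_
    · filter_upwards [(hN.tendsto_atTop.comp hκ).eventually_gt_atTop n] with i hi
      simp only [blockRadii, if_pos (show n < N (κ i) from hi)]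
      exact dyadicRadius_mono (le_max_right _ _)
    · refine Eventually.of_forall fun i => ?_
      simp only [blockRadii]
      split_ifs <;> first | exact (dyadicRadius_lt_one _).le | exact zero_le_one

/-- As `k` grows, a coordinate passes from 0 to its own level `l n` and then to `max (l n) k`; the
maximum prevents a drop after its block. -/
theorem monotone_blockRadii {N : ℕ → ℕ} (hN : StrictMono N) (l : ℕ → ℕ) (n : ℕ) :
    Monotone fun k => blockRadii N k l n := by
  refine monotone_nat_of_le_succ fun k => ?_
  have h1 := hN (Nat.lt_add_one k)
  have h2 := hN (Nat.lt_add_one (k + 1))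
  simp only [blockRadii]
  split_ifs <;> first
    | omega
    | exact dyadicRadius_nonneg _
    | exact le_rfl
    | exact dyadicRadius_mono (by omega)

theorem radialPoint_mem_polydiscC0 {r : ℕ → ℕ → ℝ} (hr : IsRadialApproach r) (k : ℕ)
    (θ : UnitAddTorus ℕ) : radialPoint (r k) θ ∈ polydiscC0 := by
  have hn : ∀ n, ‖radialPoint (r k) θ n‖ = r k n := fun n => by
    rw [radialPoint, norm_mul, norm_fourier_apply, Complex.norm_real,
      Real.norm_of_nonneg (hr.nonneg k n), mul_one]
  refine ⟨fun n => (hn n).trans_lt (hr.lt_one k n), ?_⟩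
  rw [tendsto_zero_iff_norm_tendsto_zero]
  exact (hr.tendsto_zero k).congr fun n => (hn n).symm

/-- A level at which the radial minimum is attained. -/
noncomputable def minLevel (a : ℝ) (J : ℕ) (t : UnitAddCircle) : Fin (J + 1) :=
  (exists_radialMin_eq a J t).choose

/-- Only the factors of the `k`-th block are used; all others are absorbed into the constant `exp (∑
a_n)`. -/
theorem IsAdmissible.tendsto_blockRadii (h : IsAdmissible a J) {N : ℕ → ℕ} (hN : StrictMono N)
    {θ : UnitAddTorus ℕ} (hθ : Tendsto
      (fun k => ∏ n ∈ Finset.Ico (N k) (N (k + 1)), radialMin (a n) (J n) (θ n)) atTop (𝓝 0)) :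
    Tendsto (fun k => herglotzProduct a J
      (radialPoint (blockRadii N k fun n => minLevel (a n) (J n) (θ n)) θ)) atTop (𝓝 0) := by
  refine squeeze_zero_norm (fun k => ?_) (by simpa using hθ.const_mul (Real.exp (∑' n, a n)))
  refine (h.norm_herglotzProduct_le (radialPoint_mem_polydiscC0 (isRadialApproach_blockRadii hN
    tendsto_id fun _ n => minLevel (a n) (J n) (θ n)) k θ)
    (Finset.Ico (N k) (N (k + 1)))).trans_eq ?_
  congr 1
  refine Finset.prod_congr rfl fun n hn => ?_
  rw [Finset.mem_Ico] at hn
  rw [(exists_radialMin_eq (a n) (J n) (θ n)).choose_spec, radialPoint, id_eq, blockRadii,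
    if_neg (by omega), if_pos hn.2]
  rfl

/-- Where the boundary series converges, the extension stays away from `0` along some radial
approach. -/
theorem IsAdmissible.exists_radialApproach_le_norm (h : IsAdmissible a J) {θ : UnitAddTorus ℕ}
    (hθ : Summable fun n => a n * herglotzRe (dyadicRadius (J n)) (fourier 1 (θ n))) :
    ∃ ε > 0, ∃ r : ℕ → ℕ → ℝ, IsRadialApproach r ∧
      ∀ k, ε ≤ ‖herglotzProduct a J (radialPoint (r k) θ)‖ := by
  set δ := Real.exp (-∑' n, a n * herglotzRe (dyadicRadius (J n)) (fourier 1 (θ n))) with hδ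
  have hδ0 : 0 < δ := Real.exp_pos _
  -- A finite product is continuous up to `ρ = 1`, where it is at least `δ`; a common radius close
  -- to 1 loses at most half.
  have hρ : ∀ k, ∃ ρ : ℝ, dyadicRadius k < ρ ∧ ρ < 1 ∧ δ / 2 ≤ ‖∏ n ∈ Finset.range k,
      herglotzExp (a n) (dyadicRadius (J n)) (ρ * fourier 1 (θ n))‖ := by
    intro k
    have hc : ContinuousAt (fun ρ : ℝ => ‖∏ n ∈ Finset.range k,
        herglotzExp (a n) (dyadicRadius (J n)) (ρ * fourier 1 (θ n))‖) 1 := by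
      refine (tendsto_finsetProd _ fun n _ => ?_).norm
      have hd : DifferentiableAt ℂ (herglotz (dyadicRadius (J n))) (((1 : ℝ) : ℂ) * fourier 1 (θ n)) :=
        differentiableAt_herglotz (norm_ofReal_mul_lt_one (dyadicRadius_nonneg _)
          (dyadicRadius_lt_one _) (by simpa using norm_fourier_le_one (θ n)))
      have hd' : ContinuousAt (herglotzExp (a n) (dyadicRadius (J n)))
        (((1 : ℝ) : ℂ) * fourier 1 (θ n)) := ((hd.const_mul _).neg).cexp.continuousAt
      exact ContinuousAt.comp (f := fun ρ : ℝ => (ρ : ℂ) * fourier 1 (θ n)) hd' (by fun_prop)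
    have h1 : δ / 2 < ‖∏ n ∈ Finset.range k,
        herglotzExp (a n) (dyadicRadius (J n)) ((1 : ℝ) * fourier 1 (θ n))‖ := by
      have := h.le_norm_partialProduct hθ k
      simp only [Complex.ofReal_one, one_mul]
      exact (half_lt_self hδ0).trans_le this
    have h2 := (hc.eventually (lt_mem_nhds h1)).filter_mono (nhdsWithin_le_nhds (s := Set.Iio 1))
    obtain ⟨ρ, h3, h4⟩ := (h2.and (Ioo_mem_nhdsLT (dyadicRadius_lt_one k))).exists
    exact ⟨ρ, h4.1, h4.2, h3.le⟩
  choose ρ hρ1 hρ2 hρ3 using hρ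
  refine ⟨δ / 2, by positivity, fun k n => if n < k then ρ k else 0, ⟨fun k n => ?_, fun k n => ?_,
    fun k => ?_, fun n => ?_⟩, fun k => ?_⟩
  · split_ifs
    exacts [(dyadicRadius_nonneg k).trans (hρ1 k).le, le_rfl]
  · split_ifs
    exacts [hρ2 k, zero_lt_one]
  · refine tendsto_const_nhds.congr' ?_
    filter_upwards [eventually_ge_atTop k] with n hn
    rw [if_neg (by omega)]
  · have h1 : Tendsto ρ atTop (𝓝 1) := tendsto_of_tendsto_of_tendsto_of_le_of_le
      tendsto_dyadicRadius tendsto_const_nhds (fun k => (hρ1 k).le) fun k => (hρ2 k).le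
    refine h1.congr' ?_
    filter_upwards [eventually_gt_atTop n] with k hk
    rw [if_pos hk]
  · rw [herglotzProduct_eq_prod (m := k) fun n hn => by simp [radialPoint, Nat.not_lt.2 hn]]
    refine (hρ3 k).trans_eq ?_
    congr 1
    refine Finset.prod_congr rfl fun n hn => ?_
    simp only [radialPoint, if_pos (Finset.mem_range.1 hn)]

/-- An enumeration of a disjoint union of finite nonempty types runs through the summands. -/
theorem exists_enumeration_sigma (C : ℕ → Type) [∀ k, Finite (C k)] [∀ k, Nonempty (C k)] :
    ∃ e : ℕ ≃ Σ k, C k, Tendsto (fun i => (e i).1) atTop atTop := by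
  have : Infinite (Σ k, C k) := Infinite.of_injective
    (fun k => ⟨k, Classical.arbitrary _⟩) fun i j hij => congrArg Sigma.fst hij
  obtain ⟨e⟩ := nonempty_equiv_of_countable (α := ℕ) (β := Σ k, C k)
  refine ⟨e, tendsto_atTop.2 fun K => ?_⟩
  have hfin : {x : Σ k, C k | x.1 < K}.Finite := by
    refine ((Set.finite_lt_nat K).biUnion fun k _ => Set.finite_range (Sigma.mk k)).subset ?_
    rintro ⟨k, x⟩ hk
    exact Set.mem_biUnion hk ⟨x, rfl⟩
  rw [← Nat.cofinite_eq_atTop]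
  filter_upwards [(hfin.preimage e.injective.injOn).compl_mem_cofinite] with i hi
  simpa using hi

/-- All level configurations of all blocks are listed in one sequence. Each block has finitely many,
so the block index still tends to infinity, and for each `θ` the minimising configuration of every
block occurs somewhere. -/
theorem IsAdmissible.exists_universal_radialApproach (h : IsAdmissible a J) {N : ℕ → ℕ}
    (hN : StrictMono N) : ∃ r : ℕ → ℕ → ℝ, IsRadialApproach r ∧ ∀ θ : UnitAddTorus ℕ,
      Tendsto (fun k => ∏ n ∈ Finset.Ico (N k) (N (k + 1)), radialMin (a n) (J n) (θ n))
        atTop (𝓝 0) →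
      ∃ ι : ℕ → ℕ, Tendsto ι atTop atTop ∧
        Tendsto (fun k => herglotzProduct a J (radialPoint (r (ι k)) θ)) atTop (𝓝 0) := by
  obtain ⟨e, he⟩ := exists_enumeration_sigma fun k => ∀ n : Fin (N (k + 1)), Fin (J n + 1)
  refine ⟨fun i => blockRadii N (e i).1 fun n =>
    -- The default 0 is never used: beyond the block the radius is 0 whatever the level.
    if hn : n < N ((e i).1 + 1) then (e i).2 ⟨n, hn⟩ else 0,
    isRadialApproach_blockRadii hN he _, fun θ hθ => ?_⟩
  refine ⟨fun k => e.symm ⟨k, fun n => minLevel (a n) (J n) (θ n)⟩, ?_, ?_⟩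
  · refine Function.Injective.nat_tendsto_atTop fun i j hij => ?_
    exact congrArg Sigma.fst (e.symm.injective hij)
  · refine (h.tendsto_blockRadii hN hθ).congr fun k => ?_
    congr 2
    funext n
    have := hN (Nat.lt_add_one k)
    beta_reduce
    rw [Equiv.apply_symm_apply]
    simp only [blockRadii]
    split_ifs <;> first | rfl | omega

/-! ### The main theorem -/

theorem mainTheorem5 :
    ∃ (f : UnitAddTorus ℕ → ℂ) (F : (ℕ → ℂ) → ℂ),
      MemHardy ∞ f ∧ IsPolydiscExtension f F ∧
      (∀ z ∈ polydiscC0, F z ≠ 0) ∧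
      (∀ᵐ θ ∂torusMeasure, ¬ HasUnrestrictedRadialLimit F θ) ∧
      (∀ᵐ θ ∂torusMeasure, ∃ r : ℕ → ℕ → ℝ,
        IsRadialApproach r ∧ (∀ n, Monotone fun k => r k n) ∧
        ¬ Tendsto (fun k => F (radialPoint (r k) θ)) atTop (𝓝 (f θ)) ∧
        Tendsto (fun k => ‖F (radialPoint (r k) θ)‖) atTop (𝓝 0)) ∧
      (∃ r : ℕ → ℕ → ℝ, IsRadialApproach r ∧
        ∀ᵐ θ ∂torusMeasure,
          ¬ Tendsto (fun k => F (radialPoint (r k) θ)) atTop (𝓝 (f θ))) := by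
  obtain ⟨a, J, h⟩ := exists_isAdmissible
  obtain ⟨f, φ, hf, hφ, hlim⟩ := h.exists_boundary_function
  obtain ⟨hH, hE⟩ := h.memHardy_and_extension hf hφ hlim
  obtain ⟨N, hN, hblock⟩ := h.exists_blocks
  have hne : ∀ᵐ θ ∂torusMeasure, f θ ≠ 0 := by
    filter_upwards [hlim, h.ae_summable] with θ h1 h2
    exact norm_pos_iff.1 ((Real.exp_pos _).trans_le
      (ge_of_tendsto h1.norm (Eventually.of_forall fun i => h.le_norm_partialProduct h2 _)))
  refine ⟨f, herglotzProduct a J, hH, hE, fun z _ => Complex.exp_ne_zero _, ?_, ?_, ?_⟩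
  · filter_upwards [hblock, h.ae_summable] with θ h1 h2
    rintro ⟨L, hL⟩
    have h3 := hL _ (isRadialApproach_blockRadii hN tendsto_id
      fun _ n => minLevel (a n) (J n) (θ n))
    have hL0 : L = 0 := tendsto_nhds_unique h3 (h.tendsto_blockRadii hN h1)
    -- The first approach leaves only `L = 0` as a possible limit; a second one, along which `F`
    -- stays away from 0, excludes it.
    obtain ⟨ε, hε, r, hr, hr'⟩ := h.exists_radialApproach_le_norm h2
    have h4 := ge_of_tendsto (hL r hr).norm (Eventually.of_forall hr')
    rw [hL0, norm_zero] at h4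
    exact absurd h4 (not_le.2 hε)
  · filter_upwards [hblock, hne] with θ h1 h2
    have h3 := h.tendsto_blockRadii hN h1
    refine ⟨_, isRadialApproach_blockRadii hN tendsto_id fun _ n => minLevel (a n) (J n) (θ n),
      fun n => monotone_blockRadii hN _ n, fun h4 => h2 (tendsto_nhds_unique h4 h3), ?_⟩
    simpa using h3.norm
  · obtain ⟨r, hr, hr'⟩ := h.exists_universal_radialApproach hN
    refine ⟨r, hr, ?_⟩
    filter_upwards [hblock, hne] with θ h1 h2 h3
    obtain ⟨ι, hι, h4⟩ := hr' θ h1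
    exact h2 (tendsto_nhds_unique (h3.comp hι) h4)
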